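/- All digraphs are finite, with a nonempty vertex set, without loops and without parallel arcs; a pair of opposite arcs $(u,v),(v,u)$ is allowed and is written $u\leftrightarrow v$. Undirected graphs are finite, nonempty and simple. For vertex-disjoint digraphs $G_1=(V_1,E_1)$, $G_2=(V_2,E_2)$, each of the following has vertex set $V_1\cup V_2$: the disjoint union $G_1\oplus G_2$ has arc set $E_1\cup E_2$; the order composition $G_1\oslash G_2$ has in addition all arcs $(u,v)$ with $u\in V_1$, $v\in V_2$; the series composition $G_1\otimes G_2$ has in addition all arcs $(u,v)$ and $(v,u)$ with $u\in V_1$, $v\in V_2$. The complement $\text{co-}G$ of $G=(V,E)$ has vertex set $V$ and exactly the arcs $(u,v)\notin E$ with $u\neq v$. The underlying undirected graph $un(G)$ has the edge $\{u,v\}$ iff $(u,v)$ or $(v,u)$ is an arc of $G$. The class DSC of directed simple co-graphs is the smallest isomorphism-closed class that contains the one-vertex digraph and that contains $G\oplus I$, $G\oslash I$, $I\oslash G$ and $G\otimes I$ whenever it contains $G$ and $I$ is an edgeless digraph. The class SC of simple co-graphs is the smallest isomorphism-closed class of undirected graphs that contains the one-vertex graph and that contains the disjoint union and the join of $G$ and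 $I$ whenever it contains $G$ and $I$ is an edgeless graph. A (di)graph is free of a set $F$ if none of its induced sub(di)graphs is isomorphic to a member of $F$. The following digraphs are used (pairs not mentioned are non-adjacent). - On $\{0,1,2\}$: $D_1$: $0\to1\to2$. $D_2$: $0\to 1\leftrightarrow 2$. $D_3$: $0\leftarrow 1\leftrightarrow 2$. $D_4$: $0\to1\to2$, $0\leftrightarrow 2$. $D_5$: $0\to1\to2\to0$. - On $\{0,1,2,3\}$: $D_6$: $0\leftrightarrow1\leftrightarrow2\leftrightarrow3$, $2\to0$, $3\to0$, $3\to1$. $D_7$: $0\leftrightarrow1\leftrightarrow2\leftrightarrow3$. $D_8$: $0\to1\leftarrow2\to3$. - Let $Y_1$ be $0\leftrightarrow1$ and $Y_2$ be $0\to1$ (two vertices each), let $Y_3$, $Y_4$ be $Y_1$, $Y_2$ together with one isolated vertex, and let $I_2$ be the edgeless digraph on two vertices. Then $Q_1=Y_2\otimes Y_2$, $Q_2=Y_1\oslash Y_1$, $Q_3=Y_3\otimes Y_3$, $Q_4=Y_2\otimes Y_3$, $Q_5=Y_1\oslash Y_4$, $Q_6=Y_4\oslash Y_1$, $Q_7=Y_4\oslash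 Y_4$. - $D_9=I_2\otimes I_2$, $D_{10}=I_2\otimes Y_2$, $D_{11}=Y_2\otimes Y_2$. Thus $\text{co-}D_9$, $\text{co-}D_{10}$, $\text{co-}D_{11}$ are $Y_1\oplus Y_1$, $Y_1\oplus Y_2$, $Y_2\oplus Y_2$ up to isomorphism. **Theorem.** For every digraph $G$ the following are equivalent: 1. $G\in\mathrm{DSC}$. 2. $G$ is free of $\{D_1,\dots,D_8,Q_1,\dots,Q_7,\text{co-}D_9,\text{co-}D_{10},\text{co-}D_{11}\}$. 3. $G$ is free of $\{D_1,\dots,D_8,Q_1,\dots,Q_7\}$ and $un(G)$ is free of $\{P_4,\text{co-}2P_3,2K_2\}$, where $P_n$ and $K_n$ are the undirected path and the complete graph on $n$ vertices, $2H$ is the disjoint union of two copies of $H$, and co- is the undirected complement. 4. $G$ is free of $\{D_1,\dots,D_8,Q_1,\dots,Q_7\}$ and $un(G)\in\mathrm{SC}$. -/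

import Mathlib

/-! Digraphs are finite and have no loops and no parallel arcs; they are modelled by
`Digraph V` on a finite type `V`, together with the hypothesis that no vertex is adjacent
to itself. All constructions below produce loopless digraphs from loopless digraphs. -/

namespace SimpleCograph

universe u v w

section Digraphs

/-- The edgeless digraph on `V`. -/
def edgeless (V : Type u) : Digraph V where
  Adj _ _ := False

/-- Disjoint union of two digraphs. -/
def disjUnion {V : Type u} {W : Type v} (G : Digraph V) (H : Digraph W) : Digraph (V ⊕ W) where
  Adj
    | .inl a, .inl b => G.Adj a b
    | .inr a, .inr b => H.Adj a b
    | .inl _, .inr _ => False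
    | .inr _, .inl _ => False

/-- Series composition: all arcs in both directions between the two parts. -/
def series {V : Type u} {W : Type v} (G : Digraph V) (H : Digraph W) : Digraph (V ⊕ W) where
  Adj
    | .inl a, .inl b => G.Adj a b
    | .inr a, .inr b => H.Adj a b
    | .inl _, .inr _ => True
    | .inr _, .inl _ => True

/-- Order composition: all arcs from the first part to the second part. -/
def order {V : Type u} {W : Type v} (G : Digraph V) (H : Digraph W) : Digraph (V ⊕ W) where
  Adj
    | .inl a, .inl b => G.Adj a b
    | .inr a, .inr b => H.Adj a b
    | .inl _, .inr _ => True
    | .inr _, .inl _ => False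

/-- The complement digraph; as digraphs are loopless, no loops are added. -/
def co {V : Type u} (G : Digraph V) : Digraph V where
  Adj a b := a ≠ b ∧ ¬ G.Adj a b

/-- Directed simple co-graphs. As usual, the class is closed under isomorphism. -/
inductive IsDirectedSimpleCograph : ∀ {V : Type u}, Digraph V → Prop
  | single (V : Type u) [Unique V] : IsDirectedSimpleCograph (edgeless V)
  | disjUnion_edgeless {V : Type u} (G : Digraph V) (I : Type u) [Finite I]
      (hG : IsDirectedSimpleCograph G) : IsDirectedSimpleCograph (disjUnion G (edgeless I))
  | order_edgeless {V : Type u} (G : Digraph V) (I : Type u) [Finite I]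
      (hG : IsDirectedSimpleCograph G) : IsDirectedSimpleCograph (order G (edgeless I))
  | edgeless_order {V : Type u} (G : Digraph V) (I : Type u) [Finite I]
      (hG : IsDirectedSimpleCograph G) : IsDirectedSimpleCograph (order (edgeless I) G)
  | series_edgeless {V : Type u} (G : Digraph V) (I : Type u) [Finite I]
      (hG : IsDirectedSimpleCograph G) : IsDirectedSimpleCograph (series G (edgeless I))
  | iso {V W : Type u} {G : Digraph V} {H : Digraph W} (e : G.Adj ≃r H.Adj)
      (hG : IsDirectedSimpleCograph G) : IsDirectedSimpleCograph H

/-- `G` is `F`-free: no member of `F` is isomorphic to an induced subdigraph of `G`.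
An injection that preserves and reflects arcs is an isomorphism onto the subdigraph
induced by its range. -/
def IsFree (F : Set (Σ W : Type w, Digraph W)) {V : Type u} (G : Digraph V) : Prop :=
  ∀ H ∈ F, IsEmpty (H.2.Adj ↪r G.Adj)

/-- The digraph on the vertices `0, …, n - 1` with the listed arcs. -/
def ofArcs (n : ℕ) (l : List (Fin n × Fin n)) : Digraph (Fin n) where
  Adj a b := (a, b) ∈ l

/-! The eight forbidden induced subdigraphs for directed co-graphs. -/

def D1 : Digraph (Fin 3) := ofArcs 3 [(0, 1), (1, 2)]
def D2 : Digraph (Fin 3) := ofArcs 3 [(0, 1), (1, 2), (2, 1)]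
def D3 : Digraph (Fin 3) := ofArcs 3 [(1, 0), (1, 2), (2, 1)]
def D4 : Digraph (Fin 3) := ofArcs 3 [(0, 1), (1, 2), (0, 2), (2, 0)]
def D5 : Digraph (Fin 3) := ofArcs 3 [(0, 1), (1, 2), (2, 0)]
def D6 : Digraph (Fin 4) :=
  ofArcs 4 [(0, 1), (1, 0), (1, 2), (2, 1), (2, 3), (3, 2), (2, 0), (3, 0), (3, 1)]
def D7 : Digraph (Fin 4) := ofArcs 4 [(0, 1), (1, 0), (1, 2), (2, 1), (2, 3), (3, 2)]
def D8 : Digraph (Fin 4) := ofArcs 4 [(0, 1), (2, 1), (2, 3)]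

/-! The building blocks of the forbidden digraphs below. -/

def Y1 : Digraph (Fin 2) := ofArcs 2 [(0, 1), (1, 0)]
def Y2 : Digraph (Fin 2) := ofArcs 2 [(0, 1)]
def Y3 : Digraph (Fin 3) := ofArcs 3 [(0, 1), (1, 0)]
def Y4 : Digraph (Fin 3) := ofArcs 3 [(0, 1)]

def Q1 : Digraph (Fin 2 ⊕ Fin 2) := series Y2 Y2
def Q2 : Digraph (Fin 2 ⊕ Fin 2) := order Y1 Y1
def Q3 : Digraph (Fin 3 ⊕ Fin 3) := series Y3 Y3
def Q4 : Digraph (Fin 2 ⊕ Fin 3) := series Y2 Y3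
def Q5 : Digraph (Fin 2 ⊕ Fin 3) := order Y1 Y4
def Q6 : Digraph (Fin 3 ⊕ Fin 2) := order Y4 Y1
def Q7 : Digraph (Fin 3 ⊕ Fin 3) := order Y4 Y4

def D9 : Digraph (Fin 2 ⊕ Fin 2) := series (edgeless (Fin 2)) (edgeless (Fin 2))
def D10 : Digraph (Fin 2 ⊕ Fin 2) := series (edgeless (Fin 2)) Y2
def D11 : Digraph (Fin 2 ⊕ Fin 2) := series Y2 Y2

/-- `{D₁, …, D₈, Q₁, …, Q₇}`. -/
def forbiddenDQ : Set (Σ W : Type, Digraph W) :=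
  {⟨_, D1⟩, ⟨_, D2⟩, ⟨_, D3⟩, ⟨_, D4⟩, ⟨_, D5⟩, ⟨_, D6⟩, ⟨_, D7⟩, ⟨_, D8⟩,
    ⟨_, Q1⟩, ⟨_, Q2⟩, ⟨_, Q3⟩, ⟨_, Q4⟩, ⟨_, Q5⟩, ⟨_, Q6⟩, ⟨_, Q7⟩}

/-- `{co-D₉, co-D₁₀, co-D₁₁}`. -/
def forbiddenCoD : Set (Σ W : Type, Digraph W) :=
  {⟨_, co D9⟩, ⟨_, co D10⟩, ⟨_, co D11⟩}

end Digraphs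

section Graphs

/-- The join of two undirected graphs. -/
def graphJoin {V : Type u} {W : Type v} (G : SimpleGraph V) (H : SimpleGraph W) :
    SimpleGraph (V ⊕ W) :=
  (G ⊕g H) ⊔ completeBipartiteGraph V W

/-- (Undirected) simple co-graphs. As usual, the class is closed under isomorphism. -/
inductive IsSimpleCograph : ∀ {V : Type u}, SimpleGraph V → Prop
  | single (V : Type u) [Unique V] : IsSimpleCograph (⊥ : SimpleGraph V)
  | sum_edgeless {V : Type u} (G : SimpleGraph V) (I : Type u) [Finite I]
      (hG : IsSimpleCograph G) : IsSimpleCograph (G ⊕g (⊥ : SimpleGraph I))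
  | join_edgeless {V : Type u} (G : SimpleGraph V) (I : Type u) [Finite I]
      (hG : IsSimpleCograph G) : IsSimpleCograph (graphJoin G (⊥ : SimpleGraph I))
  | iso {V W : Type u} {G : SimpleGraph V} {H : SimpleGraph W} (e : G ≃g H)
      (hG : IsSimpleCograph G) : IsSimpleCograph H

/-- `G` is `F`-free: no induced subgraph of `G` is isomorphic to a member of `F`. -/
def IsGraphFree (F : Set (Σ W : Type w, SimpleGraph W)) {V : Type u} (G : SimpleGraph V) : Prop :=
  ∀ H ∈ F, ¬ H.2.IsIndContained G

/-- `{P₄, co-2P₃, 2K₂}`. -/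
def forbiddenSC : Set (Σ W : Type, SimpleGraph W) :=
  {⟨_, SimpleGraph.pathGraph 4⟩,
    ⟨_, (SimpleGraph.pathGraph 3 ⊕g SimpleGraph.pathGraph 3)ᶜ⟩,
    ⟨_, SimpleGraph.completeGraph (Fin 2) ⊕g SimpleGraph.completeGraph (Fin 2)⟩}

end Graphs

end SimpleCograph

/-! Necessity: the last composition step building a directed simple co-graph leaves an edgeless part
uniformly related to the rest. Up to the trivial case of at most one vertex, this property,
`Separable`, passes to induced subdigraphs, and a finite check shows that no member of `forbiddenDQ`
or `forbiddenSC` has it. Forgetting directions turns order and series compositions into joins, and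
each complement in `forbiddenCoD` has underlying graph 2K₂. This settles every implication except
the one from freeness to membership.

Sufficiency: two distinct vertices are non-adjacent, joined both ways, or joined by a one-way arc.
Excluding D₁, …, D₈ forces every set of at least two vertices to split into two nonempty parts
related throughout by a single one of these types (`splits_of_one_lt_card`). The proof adds one
vertex `v` at a time: if the old splitting type `K` gives no splitting of the enlarged set, then `v`
is in relation `K` to no old vertex, and the `same_relation` lemmas make `v` uniformly related to
all of them, so `v` itself splits off.

By induction both parts of a splitting are directed simple co-graphs. In a disjoint union,
`forbiddenCoD` makes one part edgeless. In a series or order composition, the digraphs Q make one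
part decompose into independent sets by repeated splitting along the same relation. These sets are
then attached one at a time to the other part (`isDirectedSimpleCograph_induced_union_of_splits`).
-/

namespace SimpleCograph

universe u v w

/-! ### Inheritance of a separated edgeless part; underlying graphs -/

section Necessity

/-- Some set of vertices is edgeless and uniformly related to its nonempty complement. -/
def Separable {W : Type w} (R : W → W → Prop) : Prop :=
  Subsingleton W ∨ ∃ (p : W → Bool) (s t : Bool), (∃ x, p x = true) ∧ (∃ y, p y = false) ∧
    (∀ x y, p x = true → p y = true → ¬ R x y) ∧
    ∀ x y, p x = true → p y = false → (R x y ↔ s = true) ∧ (R y x ↔ t = true)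

theorem separable_of_forall_not {W : Type w} {R : W → W → Prop} (h : ∀ x y, ¬ R x y) :
    Separable R := by
  classical
  by_cases hW : Subsingleton W
  · exact Or.inl hW
  · rw [not_subsingleton_iff_nontrivial] at hW
    obtain ⟨a, b, hab⟩ := hW
    exact Or.inr ⟨fun x => decide (x = a), false, false, ⟨a, by simp⟩, ⟨b, by simpa using hab.symm⟩,
      fun x y _ _ => h x y, fun x y _ _ => by simp [h]⟩

/-- Pull the edgeless part `q` back along `f`. If its preimage is proper and nonempty it separates
`T`; if it is everything, `T` has no arcs; if it is empty, the copy lies in the remaining part,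
which is left to `ih`. -/
theorem separable_of_embedding {V : Type v} {W : Type w} {R : V → V → Prop} {T : W → W → Prop}
    (f : T ↪r R) (q : V → Bool) (s t : Bool)
    (hq : ∀ x y, q x = true → q y = true → ¬ R x y)
    (hst : ∀ x y, q x = true → q y = false → (R x y ↔ s = true) ∧ (R y x ↔ t = true))
    (ih : (∀ a, q (f a) = false) → Separable T) : Separable T := by
  by_cases h0 : ∀ a, q (f a) = false
  · exact ih h0
  by_cases h1 : ∀ a, q (f a) = true
  · exact separable_of_forall_not fun x y h => hq _ _ (h1 x) (h1 y) (f.map_rel_iff.2 h)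
  push Not at h0 h1
  refine Or.inr ⟨fun a => q (f a), s, t, ?_, ?_, ?_, ?_⟩
  · simpa using h0
  · simpa using h1
  · intro x y hx hy h
    exact hq _ _ hx hy (f.map_rel_iff.2 h)
  · intro x y hx hy
    have := hst _ _ hx hy
    rwa [f.map_rel_iff, f.map_rel_iff] at this

/-- A relation embedding whose values all lie in the range of another one factors through it. -/
theorem exists_embedding_of_forall_mem_range {V V' : Type*} {W : Type*} {R : V → V → Prop}
    {R' : V' → V' → Prop} {T : W → W → Prop} (f : T ↪r R) (g : V' → V)
    (hg : ∀ x y, R (g x) (g y) ↔ R' x y) (h : ∀ a, ∃ b, g b = f a) :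
    Nonempty (T ↪r R') := by
  choose k hk using h
  refine ⟨⟨⟨k, fun a b hab => f.injective ?_⟩, ?_⟩⟩
  · rw [← hk, ← hk, hab]
  · intro a b
    change R' (k a) (k b) ↔ T a b
    rw [← hg, hk, hk, f.map_rel_iff]

/-- Quantifying over all embedded relations, not just `G` itself, is what lets the induction descend
when the copy avoids the newest edgeless part. -/
theorem IsDirectedSimpleCograph.separable {V : Type u} {G : Digraph V}
    (hG : IsDirectedSimpleCograph G) {W : Type w} {T : W → W → Prop} (f : T ↪r G.Adj) :
    Separable T := by
  induction hG with
  | single V => exact Or.inl f.injective.subsingleton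
  | disjUnion_edgeless G I hG ih =>
    refine separable_of_embedding f Sum.isRight false false ?_ ?_ fun h => ?_
    · rintro (x | x) (y | y) <;> simp [disjUnion, edgeless]
    · rintro (x | x) (y | y) <;> simp [disjUnion]
    · obtain ⟨g⟩ := exists_embedding_of_forall_mem_range f Sum.inl
        (R' := G.Adj) (fun _ _ => Iff.rfl) fun a => by
          have := h a
          cases hfa : f a <;> simp_all
      exact ih g
  | order_edgeless G I hG ih =>
    refine separable_of_embedding f Sum.isRight false true ?_ ?_ fun h => ?_
    · rintro (x | x) (y | y) <;> simp [order, edgeless]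
    · rintro (x | x) (y | y) <;> simp [order]
    · obtain ⟨g⟩ := exists_embedding_of_forall_mem_range f Sum.inl
        (R' := G.Adj) (fun _ _ => Iff.rfl) fun a => by
          have := h a
          cases hfa : f a <;> simp_all
      exact ih g
  | edgeless_order G I hG ih =>
    refine separable_of_embedding f Sum.isLeft true false ?_ ?_ fun h => ?_
    · rintro (x | x) (y | y) <;> simp [order, edgeless]
    · rintro (x | x) (y | y) <;> simp [order]
    · obtain ⟨g⟩ := exists_embedding_of_forall_mem_range f Sum.inr
        (R' := G.Adj) (fun _ _ => Iff.rfl) fun a => by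
          have := h a
          cases hfa : f a <;> simp_all
      exact ih g
  | series_edgeless G I hG ih =>
    refine separable_of_embedding f Sum.isRight true true ?_ ?_ fun h => ?_
    · rintro (x | x) (y | y) <;> simp [series, edgeless]
    · rintro (x | x) (y | y) <;> simp [series]
    · obtain ⟨g⟩ := exists_embedding_of_forall_mem_range f Sum.inl
        (R' := G.Adj) (fun _ _ => Iff.rfl) fun a => by
          have := h a
          cases hfa : f a <;> simp_all
      exact ih g
  | iso e hG ih => exact ih (f.trans e.symm.toRelEmbedding)

theorem IsSimpleCograph.separable {V : Type u} {G : SimpleGraph V}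
    (hG : IsSimpleCograph G) {W : Type w} {T : W → W → Prop} (f : T ↪r G.Adj) :
    Separable T := by
  induction hG with
  | single V => exact Or.inl f.injective.subsingleton
  | sum_edgeless G I hG ih =>
    refine separable_of_embedding f Sum.isRight false false ?_ ?_ fun h => ?_
    · rintro (x | x) (y | y) <;> simp
    · rintro (x | x) (y | y) <;> simp
    · obtain ⟨g⟩ := exists_embedding_of_forall_mem_range f Sum.inl
        (R' := G.Adj) (fun _ _ => by simp) fun a => by
          have := h a
          cases hfa : f a <;> simp_all
      exact ih g
  | join_edgeless G I hG ih =>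
    refine separable_of_embedding f Sum.isRight true true ?_ ?_ fun h => ?_
    · rintro (x | x) (y | y) <;> simp [graphJoin]
    · rintro (x | x) (y | y) <;> simp [graphJoin]
    · obtain ⟨g⟩ := exists_embedding_of_forall_mem_range f Sum.inl
        (R' := G.Adj) (fun _ _ => by simp [graphJoin]) fun a => by
          have := h a
          cases hfa : f a <;> simp_all
      exact ih g
  | iso e hG ih => exact ih (f.trans e.symm.toRelEmbedding)

theorem IsDirectedSimpleCograph.isSimpleCograph {V : Type u} {G : Digraph V}
    (hG : IsDirectedSimpleCograph G) : IsSimpleCograph G.toSimpleGraphInclusive := by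
  induction hG with
  | single V =>
    convert IsSimpleCograph.single V
    ext x y
    simp [edgeless, Digraph.toSimpleGraphInclusive]
  | disjUnion_edgeless G I hG ih =>
    convert IsSimpleCograph.sum_edgeless _ I ih
    ext (x | x) (y | y) <;> simp [disjUnion, edgeless, Digraph.toSimpleGraphInclusive]
  | order_edgeless G I hG ih =>
    convert IsSimpleCograph.join_edgeless _ I ih
    ext (x | x) (y | y) <;> simp [order, edgeless, graphJoin, Digraph.toSimpleGraphInclusive]
  | edgeless_order G I hG ih =>
    -- Here the edgeless part is the left summand, while the undirected join has it on the right.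
    refine IsSimpleCograph.iso ⟨Equiv.sumComm _ I, ?_⟩ (IsSimpleCograph.join_edgeless _ I ih)
    rintro (x | x) (y | y) <;> simp [order, edgeless, graphJoin, Digraph.toSimpleGraphInclusive]
  | series_edgeless G I hG ih =>
    convert IsSimpleCograph.join_edgeless _ I ih
    ext (x | x) (y | y) <;> simp [series, edgeless, graphJoin, Digraph.toSimpleGraphInclusive]
  | @iso V W G H e hG ih =>
    refine IsSimpleCograph.iso ⟨e.toEquiv, ?_⟩ ih
    intro x y
    have h1 : H.Adj (e x) (e y) ↔ G.Adj x y := e.map_rel_iff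
    have h2 : H.Adj (e y) (e x) ↔ G.Adj y x := e.map_rel_iff
    simp [Digraph.toSimpleGraphInclusive, h1, h2]

end Necessity

/-! ### Decidability for the finite obstruction checks -/

section Obstructions

instance (V : Type u) : DecidableRel (edgeless V).Adj :=
  fun _ _ => inferInstanceAs (Decidable False)

instance (n : ℕ) (l : List (Fin n × Fin n)) : DecidableRel (ofArcs n l).Adj :=
  fun a b => inferInstanceAs (Decidable ((a, b) ∈ l))

instance {V : Type u} {W : Type v} (G : Digraph V) (H : Digraph W) [DecidableRel G.Adj]
    [DecidableRel H.Adj] : DecidableRel (series G H).Adj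
  | .inl a, .inl b => inferInstanceAs (Decidable (G.Adj a b))
  | .inr a, .inr b => inferInstanceAs (Decidable (H.Adj a b))
  | .inl _, .inr _ => inferInstanceAs (Decidable True)
  | .inr _, .inl _ => inferInstanceAs (Decidable True)

instance {V : Type u} {W : Type v} (G : Digraph V) (H : Digraph W) [DecidableRel G.Adj]
    [DecidableRel H.Adj] : DecidableRel (order G H).Adj
  | .inl a, .inl b => inferInstanceAs (Decidable (G.Adj a b))
  | .inr a, .inr b => inferInstanceAs (Decidable (H.Adj a b))
  | .inl _, .inr _ => inferInstanceAs (Decidable True)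
  | .inr _, .inl _ => inferInstanceAs (Decidable False)

instance {V : Type u} [DecidableEq V] (G : Digraph V) [DecidableRel G.Adj] :
    DecidableRel (co G).Adj :=
  fun a b => inferInstanceAs (Decidable (a ≠ b ∧ ¬ G.Adj a b))

instance {W : Type w} [Fintype W] (R : W → W → Prop) [DecidableRel R] (p : W → Bool) :
    Decidable (∀ x y, p x = true → p y = true → ¬ R x y) :=
  inferInstanceAs (Decidable (∀ x, ∀ y, p x = true → p y = true → ¬ R x y))

instance {W : Type w} [Fintype W] (R : W → W → Prop) [DecidableRel R] (p : W → Bool)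
    (s t : Bool) :
    Decidable (∀ x y, p x = true → p y = false → (R x y ↔ s = true) ∧ (R y x ↔ t = true)) :=
  inferInstanceAs
    (Decidable (∀ x, ∀ y, p x = true → p y = false → (R x y ↔ s = true) ∧ (R y x ↔ t = true)))

/-- Decided by running through all Boolean functions on `W`, which is why the part in `Separable` is
Boolean-valued. -/
instance {W : Type w} [Fintype W] [DecidableEq W] (R : W → W → Prop) [DecidableRel R] :
    Decidable (Separable R) :=
  @instDecidableOr _ _ (decidable_of_iff (∀ x y : W, x = y) subsingleton_iff.symm) inferInstance

instance (n : ℕ) : DecidableRel (SimpleGraph.pathGraph n).Adj :=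
  fun _ _ => decidable_of_iff _ SimpleGraph.pathGraph_adj.symm

instance {V : Type u} {W : Type v} (G : SimpleGraph V) (H : SimpleGraph W) [DecidableRel G.Adj]
    [DecidableRel H.Adj] : DecidableRel (G ⊕g H).Adj
  | .inl a, .inl b => inferInstanceAs (Decidable (G.Adj a b))
  | .inr a, .inr b => inferInstanceAs (Decidable (H.Adj a b))
  | .inl _, .inr _ => inferInstanceAs (Decidable (false = true))
  | .inr _, .inl _ => inferInstanceAs (Decidable (false = true))

end Obstructions

theorem IsDirectedSimpleCograph.isFree_forbiddenDQ {V : Type u} {G : Digraph V}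
    (hG : IsDirectedSimpleCograph G) : IsFree forbiddenDQ G := by
  intro H hH
  refine ⟨fun f => ?_⟩
  have hf := hG.separable f
  revert hf
  simp only [forbiddenDQ, Set.mem_insert_iff, Set.mem_singleton_iff] at hH
  clear f
  rcases hH with h | h | h | h | h | h | h | h | h | h | h | h | h | h | h <;> subst h
  all_goals
    -- Unfolding the names exposes `ofArcs`, `series` and `order`, for which decidability instances
    -- exist.
    simp only [D1, D2, D3, D4, D5, D6, D7, D8, Q1, Q2, Q3, Q4, Q5, Q6, Q7, Y1, Y2, Y3, Y4]
    decide +kernel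

theorem IsSimpleCograph.isGraphFree_forbiddenSC {V : Type u} {G : SimpleGraph V}
    (hG : IsSimpleCograph G) : IsGraphFree forbiddenSC G := by
  rintro H hH ⟨f⟩
  have hf := hG.separable f
  revert hf
  simp only [forbiddenSC, Set.mem_insert_iff, Set.mem_singleton_iff] at hH
  clear f
  rcases hH with h | h | h <;> subst h <;> dsimp only
  all_goals decide +kernel

/-- Copies of the complements of `D9`, `D10`, `D11` induce `2K₂` in the underlying graph. -/
theorem isFree_forbiddenCoD {V : Type u} {G : Digraph V}
    (h : IsGraphFree forbiddenSC G.toSimpleGraphInclusive) : IsFree forbiddenCoD G := by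
  intro H hH
  refine ⟨fun f => ?_⟩
  have h2 := h ⟨_, SimpleGraph.completeGraph (Fin 2) ⊕g SimpleGraph.completeGraph (Fin 2)⟩
    (by simp [forbiddenSC])
  simp only [forbiddenCoD, Set.mem_insert_iff, Set.mem_singleton_iff] at hH
  rcases hH with h | h | h <;> subst h
  all_goals
    refine h2 ⟨⟨f.toEmbedding, ?_⟩⟩
    intro a b
    change G.toSimpleGraphInclusive.Adj (f a) (f b) ↔ _
    simp only [Digraph.toSimpleGraphInclusive, SimpleGraph.fromRel_adj, f.map_rel_iff, ne_eq,
      f.injective.eq_iff]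
    clear h2 f
    simp only [D9, D10, D11, Y2]
    decide +kernel +revert

/-! ### Local consequences of excluding D₁, …, D₈ -/

section Decomposition

variable {V : Type u} {G : Digraph V}

theorem IsFree.false_of_map {F : Set (Σ W : Type w, Digraph W)} (h : IsFree F G) {W : Type w}
    {H : Digraph W} (hH : ⟨W, H⟩ ∈ F) (f : W → V) (hf : ∀ i j, f i = f j → i = j)
    (hadj : ∀ i j, G.Adj (f i) (f j) ↔ H.Adj i j) : False :=
  (h _ hH).false ⟨⟨f, fun i j => hf i j⟩, fun {i j} => hadj i j⟩

/-- `x` and `y` are distinct and joined by no arc. -/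
def NonAdj (G : Digraph V) (x y : V) : Prop := x ≠ y ∧ ¬ G.Adj x y ∧ ¬ G.Adj y x

/-- `x` and `y` are joined by arcs in both directions. -/
def BiAdj (G : Digraph V) (x y : V) : Prop := G.Adj x y ∧ G.Adj y x

/-- There is an arc from `x` to `y` and none back. -/
def Arc (G : Digraph V) (x y : V) : Prop := G.Adj x y ∧ ¬ G.Adj y x

theorem NonAdj.symm {x y : V} (h : NonAdj G x y) : NonAdj G y x := ⟨h.1.symm, h.2.2, h.2.1⟩

theorem BiAdj.symm {x y : V} (h : BiAdj G x y) : BiAdj G y x := ⟨h.2, h.1⟩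

theorem relation_cases {x y : V} (h : x ≠ y) :
    NonAdj G x y ∨ BiAdj G x y ∨ Arc G x y ∨ Arc G y x := by
  simp only [NonAdj, BiAdj, Arc]
  tauto

theorem Arc.not_biAdj {x y : V} (h : Arc G x y) : ¬ BiAdj G x y := fun h' => h.2 h'.2

theorem Arc.not_biAdj' {x y : V} (h : Arc G x y) : ¬ BiAdj G y x := fun h' => h.2 h'.1

theorem Arc.not_nonAdj {x y : V} (h : Arc G x y) : ¬ NonAdj G x y := fun h' => h'.2.1 h.1

theorem BiAdj.not_nonAdj {x y : V} (h : BiAdj G x y) : ¬ NonAdj G x y := fun h' => h'.2.1 h.1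

theorem Arc.ne {x y : V} (h : Arc G x y) : x ≠ y := by
  rintro rfl
  exact h.2 h.1

variable (hG : ∀ v, ¬ G.Adj v v) (hF : IsFree forbiddenDQ G)

include hG hF

/-- The three ways transitivity can fail, with `x` and `z` joined both ways, by the reverse arc
only, or not at all, are D₄, D₅ and D₁. -/
theorem Arc.trans {x y z : V} (hxy : Arc G x y) (hyz : Arc G y z) : Arc G x z := by
  have h1 := hG x
  have h2 := hG y
  have h3 := hG z
  have n1 : x ≠ y := fun h => h1 (h ▸ hxy.1)
  have n2 : y ≠ z := fun h => h2 (h ▸ hyz.1)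
  have n3 : x ≠ z := fun h => hxy.2 (h ▸ hyz.1)
  simp only [Arc] at *
  by_contra hc
  by_cases a1 : G.Adj x z <;> by_cases a2 : G.Adj z x
  · refine hF.false_of_map (H := D4) (by simp [forbiddenDQ]) ![x, y, z] ?_ ?_ <;>
      simp [Fin.forall_fin_succ, D4, ofArcs, *, n1.symm, n2.symm, n3.symm]
  · tauto
  · refine hF.false_of_map (H := D5) (by simp [forbiddenDQ]) ![x, y, z] ?_ ?_ <;>
      simp [Fin.forall_fin_succ, D5, ofArcs, *, n1.symm, n2.symm, n3.symm]
  · refine hF.false_of_map (H := D1) (by simp [forbiddenDQ]) ![x, y, z] ?_ ?_ <;>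
      simp [Fin.forall_fin_succ, D1, ofArcs, *, n1.symm, n2.symm, n3.symm]

theorem Arc.not_biAdj_nonAdj {x y z : V} (hxy : Arc G x y) (hyz : BiAdj G y z)
    (hxz : NonAdj G x z) : False := by
  have h1 := hG x
  have h2 := hG y
  have h3 := hG z
  have n1 : x ≠ y := fun h => h1 (h ▸ hxy.1)
  have n2 : y ≠ z := fun h => h2 (h ▸ hyz.1)
  have n3 : x ≠ z := hxz.1
  simp only [Arc, BiAdj, NonAdj] at *
  refine hF.false_of_map (H := D2) (by simp [forbiddenDQ]) ![x, y, z] ?_ ?_ <;>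
    simp [Fin.forall_fin_succ, D2, ofArcs, *, n1.symm, n2.symm, n3.symm]

theorem Arc.not_nonAdj_biAdj {x y z : V} (hyx : Arc G y x) (hyz : BiAdj G y z)
    (hxz : NonAdj G x z) : False := by
  have h1 := hG x
  have h2 := hG y
  have h3 := hG z
  have n1 : y ≠ x := fun h => h1 (h ▸ hyx.1)
  have n2 : y ≠ z := fun h => h2 (h ▸ hyz.1)
  have n3 : x ≠ z := hxz.1
  simp only [Arc, BiAdj, NonAdj] at *
  refine hF.false_of_map (H := D3) (by simp [forbiddenDQ]) ![x, y, z] ?_ ?_ <;>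
    simp [Fin.forall_fin_succ, D3, ofArcs, *, n1.symm, n2.symm, n3.symm]

/-- A vertex adjacent to two nonadjacent vertices is related to both in the same way. -/
theorem NonAdj.same_relation {x y z : V} (h : NonAdj G x z) (hx : y ≠ x) (hz : y ≠ z)
    (h1 : ¬ NonAdj G y x) (h2 : ¬ NonAdj G y z) :
    (BiAdj G y x ∧ BiAdj G y z) ∨ (Arc G y x ∧ Arc G y z) ∨ (Arc G x y ∧ Arc G z y) := by
  have t (a b c : V) (h1 : Arc G a b) (h2 : Arc G b c) := h1.trans hG hF h2
  have d2 (a b c : V) (h1 : Arc G a b) (h2 : BiAdj G b c) := h1.not_biAdj_nonAdj hG hF h2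
  have d3 (a b c : V) (h1 : Arc G b a) (h2 : BiAdj G b c) := h1.not_nonAdj_biAdj hG hF h2
  have h' := h.symm
  have e1 (a b : V) (h : Arc G a b) : ¬ NonAdj G a b := fun h' => h'.2.1 h.1
  -- A one-way arc on one side and a two-way pair on the other is D₂ or D₃; arcs into and out of `y`
  -- would compose to an arc between `x` and `z`.
  rcases relation_cases (G := G) hx with a | a | a | a <;>
    rcases relation_cases (G := G) hz with b | b | b | b <;> grind

/-- A vertex that is not joined in both directions to either end of a pair joined in both
directions is related to both ends in the same way. -/
theorem BiAdj.same_relation {x y z : V} (h : BiAdj G x z) (hx : y ≠ x) (hz : y ≠ z)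
    (h1 : ¬ BiAdj G y x) (h2 : ¬ BiAdj G y z) :
    (NonAdj G y x ∧ NonAdj G y z) ∨ (Arc G y x ∧ Arc G y z) ∨ (Arc G x y ∧ Arc G z y) := by
  have t (a b c : V) (h1 : Arc G a b) (h2 : Arc G b c) := h1.trans hG hF h2
  have d2 (a b c : V) (h1 : Arc G a b) (h2 : BiAdj G b c) := h1.not_biAdj_nonAdj hG hF h2
  have d3 (a b c : V) (h1 : Arc G b a) (h2 : BiAdj G b c) := h1.not_nonAdj_biAdj hG hF h2
  have h' := h.symm
  have e1 (a b : V) (h : Arc G a b) : ¬ BiAdj G a b := fun h' => h.2 h'.2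
  have e2 (a b : V) (h : NonAdj G a b) := h.symm
  rcases relation_cases (G := G) hx with a | a | a | a <;>
    rcases relation_cases (G := G) hz with b | b | b | b <;> grind

/-- A vertex joined by no one-way arc to either end of a one-way arc is related to both ends in
the same way. -/
theorem Arc.same_relation {x y z : V} (h : Arc G x z) (hx : y ≠ x) (hz : y ≠ z)
    (h1 : ¬ Arc G y x) (h2 : ¬ Arc G y z) (h3 : ¬ Arc G x y) (h4 : ¬ Arc G z y) :
    (NonAdj G y x ∧ NonAdj G y z) ∨ (BiAdj G y x ∧ BiAdj G y z) := by
  have d2 (a b c : V) (h1 : Arc G a b) (h2 : BiAdj G b c) := h1.not_biAdj_nonAdj hG hF h2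
  have d3 (a b c : V) (h1 : Arc G b a) (h2 : BiAdj G b c) := h1.not_nonAdj_biAdj hG hF h2
  have e2 (a b : V) (h : NonAdj G a b) := h.symm
  have e3 (a b : V) (h : BiAdj G a b) := h.symm
  rcases relation_cases (G := G) hx with a | a | a | a <;>
    rcases relation_cases (G := G) hz with b | b | b | b <;> grind

theorem false_of_D7 {a b c d : V} (hab : BiAdj G a b) (hbc : BiAdj G b c) (hcd : BiAdj G c d)
    (hac : NonAdj G a c) (hbd : NonAdj G b d) (had : NonAdj G a d) : False := by
  have h1 := hG a
  have h2 := hG b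
  have h3 := hG c
  have h4 := hG d
  have n1 : a ≠ b := fun h => h1 (h ▸ hab.1)
  have n2 : b ≠ c := fun h => h2 (h ▸ hbc.1)
  have n3 : c ≠ d := fun h => h3 (h ▸ hcd.1)
  simp only [BiAdj, NonAdj] at *
  refine hF.false_of_map (H := D7) (by simp [forbiddenDQ]) ![a, b, c, d] ?_ ?_ <;>
    simp [Fin.forall_fin_succ, D7, ofArcs, *, n1.symm, n2.symm, n3.symm, hac.1.symm, hbd.1.symm,
      had.1.symm]

theorem false_of_D6 {a b c d : V} (hab : BiAdj G a b) (hbc : BiAdj G b c) (hcd : BiAdj G c d)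
    (hca : Arc G c a) (hdb : Arc G d b) (hda : Arc G d a) : False := by
  have h1 := hG a
  have h2 := hG b
  have h3 := hG c
  have h4 := hG d
  have n1 : a ≠ b := fun h => h1 (h ▸ hab.1)
  have n2 : b ≠ c := fun h => h2 (h ▸ hbc.1)
  have n3 : c ≠ d := fun h => h3 (h ▸ hcd.1)
  have n4 := hca.ne
  have n5 := hdb.ne
  have n6 := hda.ne
  simp only [BiAdj, Arc] at *
  refine hF.false_of_map (H := D6) (by simp [forbiddenDQ]) ![a, b, c, d] ?_ ?_ <;>
    simp [Fin.forall_fin_succ, D6, ofArcs, *, n1.symm, n2.symm, n3.symm, n4.symm, n5.symm, n6.symm]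

theorem false_of_D8 {a b c d : V} (hab : Arc G a b) (hcb : Arc G c b) (hcd : Arc G c d)
    (hac : NonAdj G a c) (hbd : NonAdj G b d) (had : NonAdj G a d) : False := by
  have h1 := hG a
  have h2 := hG b
  have h3 := hG c
  have h4 := hG d
  have n1 := hab.ne
  have n2 := hcb.ne
  have n3 := hcd.ne
  simp only [Arc, NonAdj] at *
  refine hF.false_of_map (H := D8) (by simp [forbiddenDQ]) ![a, b, c, d] ?_ ?_ <;>
    simp [Fin.forall_fin_succ, D8, ofArcs, *, n1.symm, n2.symm, n3.symm, hac.1.symm, hbd.1.symm,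
      had.1.symm]

/-- The graph of adjacent pairs has no induced path on four vertices. -/
theorem false_of_path_not_nonAdj {a b c d : V} (nab : a ≠ b) (nbc : b ≠ c) (ncd : c ≠ d)
    (hab : ¬ NonAdj G a b) (hbc : ¬ NonAdj G b c) (hcd : ¬ NonAdj G c d)
    (hac : NonAdj G a c) (hbd : NonAdj G b d) (had : NonAdj G a d) : False := by
  -- The two applications force all three edges to be two-way, or all one-way with alternating
  -- directions: D₇ or D₈. The other combinations disagree on the pair `b`, `c`.
  rcases hac.same_relation hG hF nab.symm nbc (fun h => hab h.symm) hbc with h | h | h <;>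
    rcases hbd.same_relation hG hF nbc.symm ncd (fun h => hbc h.symm) hcd with h' | h' | h'
  · exact false_of_D7 hG hF h.1.symm h.2 h'.2 hac hbd had
  · exact h'.1.not_biAdj' h.2
  · exact h'.1.not_biAdj h.2
  · exact h.2.not_biAdj' h'.1
  · exact h.2.2 h'.1.1
  · exact false_of_D8 hG hF h'.2 h.2 h.1 hbd.symm hac.symm had.symm
  · exact h.2.not_biAdj h'.1
  · exact false_of_D8 hG hF h.1 h.2 h'.2 hac hbd had
  · exact h.2.2 h'.1.1

/-- The graph of pairs joined in both directions has no induced path on four vertices. -/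
theorem false_of_path_biAdj {a b c d : V} (nac : a ≠ c) (nbd : b ≠ d) (nad : a ≠ d)
    (hab : BiAdj G a b) (hbc : BiAdj G b c) (hcd : BiAdj G c d)
    (hac : ¬ BiAdj G a c) (hbd : ¬ BiAdj G b d) (had : ¬ BiAdj G a d) : False := by
  -- The complementary path `c`, `a`, `d`, `b` consists of pairs not joined both ways. They are all
  -- non-adjacent (D₇) or all one-way with alternating directions (D₆).
  rcases hcd.same_relation hG hF nac nad hac had with h | h | h <;>
    rcases hab.same_relation hG hF nad.symm nbd.symm (fun h => had h.symm) (fun h => hbd h.symm)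
      with h' | h' | h'
  · exact false_of_D7 hG hF hab hbc hcd h.1 h'.2.symm h.2
  · exact h'.1.not_nonAdj h.2.symm
  · exact h'.1.not_nonAdj h.2
  · exact h.2.not_nonAdj h'.1.symm
  · exact h.2.2 h'.1.1
  · exact false_of_D6 hG hF hcd.symm hbc.symm hab.symm h'.2 h.1 h.2
  · exact h.2.not_nonAdj h'.1
  · exact false_of_D6 hG hF hab hbc hcd h.1 h'.2 h.2
  · exact h.2.2 h'.1.1

/-- The graph of one-way arcs has no induced path on four vertices. -/
theorem false_of_path_arc {a b c d : V} (nac : a ≠ c) (nbd : b ≠ d) (nad : a ≠ d)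
    (hab : Arc G a b) (hcb : Arc G c b) (hcd : Arc G c d)
    (hac : ¬ Arc G a c) (hca : ¬ Arc G c a) (hbd : ¬ Arc G b d) (hdb : ¬ Arc G d b)
    (had : ¬ Arc G a d) (hda : ¬ Arc G d a) : False := by
  rcases hcd.same_relation hG hF nac nad hac had hca hda with h | h <;>
    rcases hab.same_relation hG hF nad.symm nbd.symm hda hdb had hbd with h' | h'
  · exact false_of_D8 hG hF hab hcb hcd h.1 h'.2.symm h.2
  · exact h'.1.not_nonAdj h.2.symm
  · exact h.2.not_nonAdj h'.1.symm
  · exact false_of_D6 hG hF h'.2.symm h'.1 h.1 hab hcd hcb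

end Decomposition

/-! ### Splitting a vertex set along one relation -/

section Splitting

variable {V : Type u} {G : Digraph V}

/-- `S` has a partition into two nonempty parts such that `K` holds from the first part to the
second. -/
def Splits (K : V → V → Prop) (S : Finset V) : Prop :=
  ∃ p : V → Prop, (∃ x ∈ S, p x) ∧ (∃ y ∈ S, ¬ p y) ∧ ∀ x ∈ S, p x → ∀ y ∈ S, ¬ p y → K x y

/-- If a property takes the same values on both sides of a partition, then it holds everywhere as
soon as it holds somewhere. -/
theorem forall_of_forall_iff {S : Finset V} {p L : V → Prop} (hp : ∃ x ∈ S, p x)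
    (hp' : ∃ y ∈ S, ¬ p y) (h : ∀ x ∈ S, p x → ∀ y ∈ S, ¬ p y → (L x ↔ L y))
    {z : V} (hz : z ∈ S) (hL : L z) : ∀ x ∈ S, L x := by
  obtain ⟨a, ha, hpa⟩ := hp
  obtain ⟨b, hb, hpb⟩ := hp'
  have hab := h a ha hpa b hb hpb
  have key : L a := by
    by_cases hpz : p z
    · exact hab.2 ((h z hz hpz b hb hpb).1 hL)
    · exact (h a ha hpa z hz hpz).2 hL
  intro x hx
  by_cases hpx : p x
  · exact (h x hx hpx b hb hpb).2 (hab.1 key)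
  · exact (h a ha hpa x hx hpx).1 key

variable [DecidableEq V]

theorem splits_insert_of_forall {K : V → V → Prop} {S : Finset V} {v : V} (hv : v ∉ S)
    (hS : S.Nonempty) (h : ∀ x ∈ S, K v x) : Splits K (insert v S) := by
  obtain ⟨z, hz⟩ := hS
  refine ⟨fun x => x = v, ⟨v, by simp⟩, ⟨z, by simp [hz], fun e => hv (e ▸ hz)⟩, ?_⟩
  rintro x - rfl y hy hne
  exact h y ((Finset.mem_insert.1 hy).resolve_left hne)

theorem splits_insert_of_forall' {K : V → V → Prop} {S : Finset V} {v : V} (hv : v ∉ S)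
    (hS : S.Nonempty) (h : ∀ x ∈ S, K x v) : Splits K (insert v S) := by
  obtain ⟨z, hz⟩ := hS
  refine ⟨fun x => x ≠ v, ⟨z, by simp [hz], fun e => hv (e ▸ hz)⟩, ⟨v, by simp⟩, ?_⟩
  intro x hx hne y _ hy
  obtain rfl := not_not.1 hy
  exact h x ((Finset.mem_insert.1 hx).resolve_left hne)

section Symmetric

variable {K : V → V → Prop} (hsymm : ∀ {x y}, K x y → K y x) {S : Finset V} {v : V} (hv : v ∉ S)
  (hnot : ¬ Splits K (insert v S))

include hsymm hv hnot

/-- Otherwise `v` could join the second part, and the old splitting would extend to `insert v S`. -/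
theorem exists_not_of_not_splits_insert {p : V → Prop} (hp : ∃ x ∈ S, p x)
    (h : ∀ x ∈ S, p x → ∀ y ∈ S, ¬ p y → K x y) : ∃ c ∈ S, p c ∧ ¬ K v c := by
  by_contra! hc
  obtain ⟨x, hx, hpx⟩ := hp
  refine hnot ⟨fun x => x ∈ S ∧ p x, ⟨x, by simp [hx], hx, hpx⟩, ⟨v, by simp, fun h => hv h.1⟩, ?_⟩
  rintro x - ⟨hx, hpx⟩ y hy hpy
  rcases Finset.mem_insert.1 hy with rfl | hy
  · exact hsymm (hc x hx hpx)
  · exact h x hx hpx y hy fun h => hpy ⟨hy, h⟩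

/-- The vertices of the first part in relation `K` to `v` would split off from everything else. An
obstructing pair `a`, `y` would make `a`, `y`, `v`, `c` an induced path in the complement of `K`,
which `hpath` excludes. -/
theorem forall_not_of_not_splits_insert
    (hpath : ∀ {a b c d}, a ≠ b → b ≠ c → c ≠ d → ¬ K a b → ¬ K b c → ¬ K c d →
      K a c → K b d → K a d → False)
    {p : V → Prop} (h : ∀ x ∈ S, p x → ∀ y ∈ S, ¬ p y → K x y) {c : V} (hc : c ∈ S) (hpc : ¬ p c)
    (hvc : ¬ K v c) : ∀ x ∈ S, p x → ¬ K v x := by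
  intro x hx hpx hvx
  refine hnot ⟨fun x => x ∈ S ∧ p x ∧ K v x, ⟨x, by simp [hx], hx, hpx, hvx⟩,
    ⟨v, by simp, fun h => hv h.1⟩, ?_⟩
  rintro a - ⟨ha, hpa, hva⟩ y hy hpy
  by_contra hK
  rcases Finset.mem_insert.1 hy with rfl | hy
  · exact hK (hsymm hva)
  by_cases hq : p y
  · have hvy : ¬ K v y := fun h => hpy ⟨hy, hq, h⟩
    exact hpath (a := a) (b := y) (c := v) (d := c) (fun e => hvy (e ▸ hva)) (fun e => hv (e ▸ hy))
      (fun e => hv (e ▸ hc)) hK (fun h => hvy (hsymm h)) hvc (hsymm hva) (h y hy hq c hc hpc)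
      (h a ha hpa c hc hpc)
  · exact hK (h a ha hpa y hy hq)

theorem forall_not_of_splits
    (hpath : ∀ {a b c d}, a ≠ b → b ≠ c → c ≠ d → ¬ K a b → ¬ K b c → ¬ K c d →
      K a c → K b d → K a d → False)
    {p : V → Prop} (hp : ∃ x ∈ S, p x) (hp' : ∃ x ∈ S, ¬ p x)
    (h : ∀ x ∈ S, p x → ∀ y ∈ S, ¬ p y → K x y) : ∀ x ∈ S, ¬ K v x := by
  have h' : ∀ x ∈ S, ¬ p x → ∀ y ∈ S, ¬ ¬ p y → K x y :=
    fun x hx hpx y hy hpy => hsymm (h y hy (not_not.1 hpy) x hx hpx)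
  obtain ⟨c, hc, hpc, hvc⟩ := exists_not_of_not_splits_insert hsymm hv hnot hp h
  obtain ⟨d, hd, hpd, hvd⟩ := exists_not_of_not_splits_insert hsymm hv hnot hp' h'
  intro x hx
  by_cases hpx : p x
  · exact forall_not_of_not_splits_insert hsymm hv hnot hpath h hd hpd hvd x hx hpx
  · exact forall_not_of_not_splits_insert hsymm hv hnot hpath h' hc (not_not.2 hpc) hvc x hx hpx

end Symmetric

variable (hG : ∀ v, ¬ G.Adj v v) (hF : IsFree forbiddenDQ G)

include hG hF

theorem splits_insert_of_splits_nonAdj {S : Finset V} {v : V} (hv : v ∉ S)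
    (h : Splits (NonAdj G) S) :
    Splits (NonAdj G) (insert v S) ∨ Splits (BiAdj G) (insert v S) ∨
      Splits (Arc G) (insert v S) := by
  by_contra! hc
  obtain ⟨hN, hB, hA⟩ := hc
  obtain ⟨p, hp, hp', hK⟩ := h
  have hne (x) (hx : x ∈ S) : v ≠ x := fun e => hv (e ▸ hx)
  have hS : S.Nonempty := let ⟨x, hx, _⟩ := hp; ⟨x, hx⟩
  have hall := forall_not_of_splits NonAdj.symm hv hN
    (fun {a b c d} h1 h2 h3 h4 h5 h6 h7 h8 h9 =>
      false_of_path_not_nonAdj hG hF h1 h2 h3 h4 h5 h6 h7 h8 h9) hp hp' hK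
  have key (x) (hx : x ∈ S) (hpx : p x) (y) (hy : y ∈ S) (hpy : ¬ p y) :=
    (hK x hx hpx y hy hpy).same_relation hG hF (hne x hx) (hne y hy) (hall x hx) (hall y hy)
  have e1 (a b : V) (h : Arc G a b) : ¬ BiAdj G a b := fun h' => h.2 h'.2
  have e2 (a b : V) (h : Arc G a b) : ¬ BiAdj G b a := fun h' => h.2 h'.1
  have e3 (a b : V) (h : Arc G a b) : ¬ Arc G b a := fun h' => h.2 h'.1
  obtain ⟨z, hz⟩ := hS
  rcases relation_cases (G := G) (hne z hz) with h | h | h | h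
  · exact hall z hz h
  · exact hB (splits_insert_of_forall hv ⟨z, hz⟩
      (forall_of_forall_iff (L := fun x => BiAdj G v x) hp hp'
        (fun x hx hpx y hy hpy => by grind) hz h))
  · exact hA (splits_insert_of_forall hv ⟨z, hz⟩
      (forall_of_forall_iff (L := fun x => Arc G v x) hp hp'
        (fun x hx hpx y hy hpy => by grind) hz h))
  · exact hA (splits_insert_of_forall' hv ⟨z, hz⟩
      (forall_of_forall_iff (L := fun x => Arc G x v) hp hp'
        (fun x hx hpx y hy hpy => by grind) hz h))

theorem splits_insert_of_splits_biAdj {S : Finset V} {v : V} (hv : v ∉ S)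
    (h : Splits (BiAdj G) S) :
    Splits (NonAdj G) (insert v S) ∨ Splits (BiAdj G) (insert v S) ∨
      Splits (Arc G) (insert v S) := by
  by_contra! hc
  obtain ⟨hN, hB, hA⟩ := hc
  obtain ⟨p, hp, hp', hK⟩ := h
  have hne (x) (hx : x ∈ S) : v ≠ x := fun e => hv (e ▸ hx)
  have hS : S.Nonempty := let ⟨x, hx, _⟩ := hp; ⟨x, hx⟩
  have hall := forall_not_of_splits BiAdj.symm hv hB
    (fun {a b c d} h1 h2 h3 h4 h5 h6 h7 h8 h9 =>
      -- The hypothesis concerns a path of pairs outside `K`; P₄ is self-complementary, so `c`, `a`,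
      -- `d`, `b` is a path of pairs in `K`.
      false_of_path_biAdj (a := c) (b := a) (c := d) (d := b) hG hF h3 h1 h2.symm
        h7.symm h9 h8.symm h6 h4 fun h => h5 h.symm) hp hp' hK
  have key (x) (hx : x ∈ S) (hpx : p x) (y) (hy : y ∈ S) (hpy : ¬ p y) :=
    (hK x hx hpx y hy hpy).same_relation hG hF (hne x hx) (hne y hy) (hall x hx) (hall y hy)
  have e1 (a b : V) (h : Arc G a b) : ¬ NonAdj G a b := fun h' => h'.2.1 h.1
  have e2 (a b : V) (h : Arc G a b) : ¬ NonAdj G b a := fun h' => h'.2.2 h.1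
  have e3 (a b : V) (h : Arc G a b) : ¬ Arc G b a := fun h' => h.2 h'.1
  obtain ⟨z, hz⟩ := hS
  rcases relation_cases (G := G) (hne z hz) with h | h | h | h
  · exact hN (splits_insert_of_forall hv ⟨z, hz⟩
      (forall_of_forall_iff (L := fun x => NonAdj G v x) hp hp'
        (fun x hx hpx y hy hpy => by grind) hz h))
  · exact hall z hz h
  · exact hA (splits_insert_of_forall hv ⟨z, hz⟩
      (forall_of_forall_iff (L := fun x => Arc G v x) hp hp'
        (fun x hx hpx y hy hpy => by grind) hz h))
  · exact hA (splits_insert_of_forall' hv ⟨z, hz⟩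
      (forall_of_forall_iff (L := fun x => Arc G x v) hp hp'
        (fun x hx hpx y hy hpy => by grind) hz h))

/-- `Arc` is not symmetric, so the general argument does not apply. Transitivity excludes arcs from
`v` to the first part and from the second part to `v`; the path argument excludes the other two
directions. -/
theorem splits_insert_of_splits_arc {S : Finset V} {v : V} (hv : v ∉ S)
    (h : Splits (Arc G) S) :
    Splits (NonAdj G) (insert v S) ∨ Splits (BiAdj G) (insert v S) ∨
      Splits (Arc G) (insert v S) := by
  by_contra! hc
  obtain ⟨hN, hB, hA⟩ := hc
  obtain ⟨p, hp, hp', hK⟩ := h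
  have hne (x) (hx : x ∈ S) : v ≠ x := fun e => hv (e ▸ hx)
  have hS : S.Nonempty := let ⟨x, hx, _⟩ := hp; ⟨x, hx⟩
  obtain ⟨x₁, hx₁, hpx₁, hx₁v⟩ : ∃ x ∈ S, p x ∧ ¬ Arc G x v := by
    by_contra! h
    obtain ⟨x, hx, hpx⟩ := hp
    refine hA ⟨fun x => x ∈ S ∧ p x, ⟨x, by simp [hx], hx, hpx⟩,
      ⟨v, by simp, fun h => hv h.1⟩, ?_⟩
    rintro a - ⟨ha, hpa⟩ y hy hpy
    rcases Finset.mem_insert.1 hy with rfl | hy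
    · exact h a ha hpa
    · exact hK a ha hpa y hy fun h => hpy ⟨hy, h⟩
  obtain ⟨y₁, hy₁, hpy₁, hy₁v⟩ : ∃ y ∈ S, ¬ p y ∧ ¬ Arc G v y := by
    by_contra! h
    obtain ⟨y, hy, hpy⟩ := hp'
    refine hA ⟨fun x => x ∉ S ∨ p x, ⟨v, by simp, Or.inl hv⟩, ⟨y, by simp [hy], by simp [hy, hpy]⟩,
      ?_⟩
    intro a ha hpa y hy hpy
    simp only [not_or, not_not] at hpy
    rcases Finset.mem_insert.1 ha with rfl | ha
    · exact h y hpy.1 hpy.2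
    · exact hK a ha (hpa.resolve_left (not_not.2 ha)) y hpy.1 hpy.2
  have hvx (x) (hx : x ∈ S) (hpx : p x) : ¬ Arc G v x := fun h =>
    hy₁v (h.trans hG hF (hK x hx hpx y₁ hy₁ hpy₁))
  have hyv (y) (hy : y ∈ S) (hpy : ¬ p y) : ¬ Arc G y v := fun h =>
    hx₁v ((hK x₁ hx₁ hpx₁ y hy hpy).trans hG hF h)
  have hxv (x) (hx : x ∈ S) (hpx : p x) : ¬ Arc G x v := by
    intro hxv
    -- The in-neighbours of `v` in the first part would split off; a failing pair `a`, `b` yields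
    -- the path `b`, `y₁`, `a`, `v` of one-way arcs.
    refine hA ⟨fun x => x ∈ S ∧ p x ∧ Arc G x v, ⟨x, by simp [hx], hx, hpx, hxv⟩,
      ⟨v, by simp, fun h => hv h.1⟩, ?_⟩
    rintro a - ⟨ha, hpa, hav⟩ b hb hpb
    by_contra hab
    rcases Finset.mem_insert.1 hb with rfl | hb
    · exact hab hav
    by_cases hq : p b
    · have hbv : ¬ Arc G b v := fun h => hpb ⟨hb, hq, h⟩
      exact false_of_path_arc (a := b) (b := y₁) (c := a) (d := v) hG hF
        (fun e => hbv (e ▸ hav)) (hne y₁ hy₁).symm (hne b hb).symm (hK b hb hq y₁ hy₁ hpy₁)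
        (hK a ha hpa y₁ hy₁ hpy₁) hav (fun h => hbv (h.trans hG hF hav)) hab
        (hyv y₁ hy₁ hpy₁) hy₁v hbv (hvx b hb hq)
    · exact hab (hK a ha hpa b hb hq)
  have hvy (y) (hy : y ∈ S) (hpy : ¬ p y) : ¬ Arc G v y := by
    intro hvy
    refine hA ⟨fun y => ¬ (y ∈ S ∧ ¬ p y ∧ Arc G v y), ⟨v, by simp, fun h => hv h.1⟩,
      ⟨y, by simp [hy], not_not.2 ⟨hy, hpy, hvy⟩⟩, ?_⟩
    intro b hb hpb a _ ha
    obtain ⟨ha, hpa, hva⟩ := not_not.1 ha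
    by_contra hba
    rcases Finset.mem_insert.1 hb with rfl | hb
    · exact hba hva
    by_cases hq : p b
    · exact hba (hK b hb hq a ha hpa)
    · have hvb : ¬ Arc G v b := fun h => hpb ⟨hb, hq, h⟩
      exact false_of_path_arc (a := v) (b := a) (c := x₁) (d := b) hG hF
        (hne x₁ hx₁) (fun e => hvb (e ▸ hva)) (hne b hb) hva
        (hK x₁ hx₁ hpx₁ a ha hpa) (hK x₁ hx₁ hpx₁ b hb hq) (hvx x₁ hx₁ hpx₁) hx₁v
        (fun h => hvb (hva.trans hG hF h)) hba hvb (hyv b hb hq)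
  have hall (z) (hz : z ∈ S) : ¬ Arc G v z ∧ ¬ Arc G z v := by
    by_cases hpz : p z
    · exact ⟨hvx z hz hpz, hxv z hz hpz⟩
    · exact ⟨hvy z hz hpz, hyv z hz hpz⟩
  have key (x) (hx : x ∈ S) (hpx : p x) (y) (hy : y ∈ S) (hpy : ¬ p y) :=
    (hK x hx hpx y hy hpy).same_relation hG hF (hne x hx) (hne y hy) (hall x hx).1 (hall y hy).1
      (hall x hx).2 (hall y hy).2
  have e1 (a b : V) (h : BiAdj G a b) : ¬ NonAdj G a b := fun h' => h'.2.1 h.1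
  obtain ⟨z, hz⟩ := hS
  rcases relation_cases (G := G) (hne z hz) with h | h | h | h
  · exact hN (splits_insert_of_forall hv ⟨z, hz⟩
      (forall_of_forall_iff (L := fun x => NonAdj G v x) hp hp'
        (fun x hx hpx y hy hpy => by grind) hz h))
  · exact hB (splits_insert_of_forall hv ⟨z, hz⟩
      (forall_of_forall_iff (L := fun x => BiAdj G v x) hp hp'
        (fun x hx hpx y hy hpy => by grind) hz h))
  · exact (hall z hz).1 h
  · exact (hall z hz).2 h

/-- In a digraph without the eight obstructions to being a directed co-graph, every set of at
least two vertices is a disjoint union, a series composition or an order composition. -/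
theorem splits_of_one_lt_card {S : Finset V} (hS : 1 < S.card) :
    Splits (NonAdj G) S ∨ Splits (BiAdj G) S ∨ Splits (Arc G) S := by
  induction S using Finset.induction_on with
  | empty => simp at hS
  | insert v S hv ih =>
    have hne : S.Nonempty := by
      rw [Finset.card_insert_of_notMem hv] at hS
      exact Finset.card_pos.1 (by omega)
    obtain h1 | h1 := lt_or_ge 1 S.card
    · rcases ih h1 with h | h | h
      · exact splits_insert_of_splits_nonAdj hG hF hv h
      · exact splits_insert_of_splits_biAdj hG hF hv h
      · exact splits_insert_of_splits_arc hG hF hv h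
    · obtain ⟨z, rfl⟩ := Finset.card_eq_one.1 (le_antisymm h1 hne.card_pos)
      have hvz : v ≠ z := by simpa using hv
      rcases relation_cases (G := G) hvz with h | h | h | h
      · exact Or.inl (splits_insert_of_forall hv hne (by simpa using h))
      · exact Or.inr (Or.inl (splits_insert_of_forall hv hne (by simpa using h)))
      · exact Or.inr (Or.inr (splits_insert_of_forall hv hne (by simpa using h)))
      · exact Or.inr (Or.inr (splits_insert_of_forall' hv hne (by simpa using h)))

end Splitting

/-! ### Rebuilding the digraph from edgeless pieces -/

section Sufficiency

variable {V : Type u} {G : Digraph V}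

/-- The subdigraph of `G` induced by `S`. -/
def induced (G : Digraph V) (S : Finset V) : Digraph S where
  Adj a b := G.Adj a b

/-- `S` spans no arc. -/
def Independent (G : Digraph V) (S : Finset V) : Prop := ∀ x ∈ S, ∀ y ∈ S, ¬ G.Adj x y

/-- `S` contains the vertices of an induced copy of `H`. -/
def HasCopy {W : Type w} (G : Digraph V) (S : Finset V) (H : Digraph W) : Prop :=
  ∃ f : H.Adj ↪r G.Adj, ∀ a, f a ∈ S

theorem hasCopy_of_map {S : Finset V} {W : Type w} {H : Digraph W} (f : W → V)
    (hf : ∀ i j, f i = f j → i = j) (hadj : ∀ i j, G.Adj (f i) (f j) ↔ H.Adj i j)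
    (hS : ∀ i, f i ∈ S) : HasCopy G S H :=
  ⟨⟨⟨f, fun i j => hf i j⟩, fun {i j} => hadj i j⟩, hS⟩

section Attach

variable [DecidableEq V] {X I : Finset V} (hX : IsDirectedSimpleCograph (induced G X))
  (hI : Independent G I)

theorem isDirectedSimpleCograph_induced_union {H : Digraph (X ⊕ I)} (hXI : Disjoint X I)
    (hH : IsDirectedSimpleCograph H)
    (h : ∀ a b, H.Adj a b ↔ G.Adj (Sum.elim (↑) (↑) a) (Sum.elim (↑) (↑) b)) :
    IsDirectedSimpleCograph (induced G (I ∪ X)) := by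
  rw [Finset.union_comm]
  refine hH.iso ⟨Equiv.Finset.union X I hXI, ?_⟩
  intro a b
  rw [h]
  rcases a with a | a <;> rcases b with b | b <;> rfl

include hX hI

theorem isDirectedSimpleCograph_induced_union_of_nonAdj
    (h : ∀ i ∈ I, ∀ x ∈ X, NonAdj G i x) : IsDirectedSimpleCograph (induced G (I ∪ X)) := by
  refine isDirectedSimpleCograph_induced_union ?_ (hX.disjUnion_edgeless _ I) ?_
  · exact Finset.disjoint_left.2 fun x hx hi => (h x hi x hx).1 rfl
  · rintro (⟨a, ha⟩ | ⟨a, ha⟩) (⟨b, hb⟩ | ⟨b, hb⟩)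
    · rfl
    · simpa [disjUnion] using (h b hb a ha).2.2
    · simpa [disjUnion] using (h a ha b hb).2.1
    · simpa [disjUnion, edgeless] using hI a ha b hb

theorem isDirectedSimpleCograph_induced_union_of_biAdj (hG : ∀ v, ¬ G.Adj v v)
    (h : ∀ i ∈ I, ∀ x ∈ X, BiAdj G i x) : IsDirectedSimpleCograph (induced G (I ∪ X)) := by
  refine isDirectedSimpleCograph_induced_union ?_ (hX.series_edgeless _ I) ?_
  · exact Finset.disjoint_left.2 fun x hx hi => hG x (h x hi x hx).1
  · rintro (⟨a, ha⟩ | ⟨a, ha⟩) (⟨b, hb⟩ | ⟨b, hb⟩)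
    · rfl
    · simpa [series] using (h b hb a ha).2
    · simpa [series] using (h a ha b hb).1
    · simpa [series, edgeless] using hI a ha b hb

theorem isDirectedSimpleCograph_induced_union_of_arc_to
    (h : ∀ i ∈ I, ∀ x ∈ X, Arc G x i) : IsDirectedSimpleCograph (induced G (I ∪ X)) := by
  refine isDirectedSimpleCograph_induced_union ?_ (hX.order_edgeless _ I) ?_
  · exact Finset.disjoint_left.2 fun x hx hi => (h x hi x hx).ne rfl
  · rintro (⟨a, ha⟩ | ⟨a, ha⟩) (⟨b, hb⟩ | ⟨b, hb⟩)
    · rfl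
    · simpa [order] using (h b hb a ha).1
    · simpa [order] using (h a ha b hb).2
    · simpa [order, edgeless] using hI a ha b hb

theorem isDirectedSimpleCograph_induced_union_of_arc_from
    (h : ∀ i ∈ I, ∀ x ∈ X, Arc G i x) : IsDirectedSimpleCograph (induced G (I ∪ X)) := by
  rw [Finset.union_comm]
  refine isDirectedSimpleCograph_induced_union (X := I) (I := X) ?_ (hX.edgeless_order _ I) ?_
  · exact Finset.disjoint_left.2 fun x hi hx => (h x hi x hx).ne rfl
  · rintro (⟨a, ha⟩ | ⟨a, ha⟩) (⟨b, hb⟩ | ⟨b, hb⟩)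
    · simpa [order, edgeless] using hI a ha b hb
    · simpa [order] using (h a ha b hb).1
    · simpa [order] using (h b hb a ha).2
    · rfl

end Attach

/-- If independent sets can be attached along `K`, then so can every set all of whose subsets are
independent or split along `K`. -/
theorem isDirectedSimpleCograph_induced_union_of_splits [DecidableEq V] {K : V → V → Prop}
    (attach : ∀ X I, IsDirectedSimpleCograph (induced G X) → Independent G I →
      (∀ i ∈ I, ∀ x ∈ X, K i x) → IsDirectedSimpleCograph (induced G (I ∪ X)))
    {S : Finset V} (hS : ∀ T ⊆ S, Independent G T ∨ Splits K T) {X : Finset V}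
    (hX : IsDirectedSimpleCograph (induced G X)) (hSX : ∀ s ∈ S, ∀ x ∈ X, K s x) :
    IsDirectedSimpleCograph (induced G (S ∪ X)) := by
  classical
  induction S using Finset.strongInduction generalizing X with
  | H S ih =>
    rcases hS S subset_rfl with h | ⟨p, ⟨a, ha, hpa⟩, ⟨b, hb, hpb⟩, h⟩
    · exact attach X S hX h hSX
    · have h1 : S.filter p ⊂ S := Finset.filter_ssubset.2 ⟨b, hb, hpb⟩
      have h2 : S.filter (fun x => ¬ p x) ⊂ S := Finset.filter_ssubset.2 ⟨a, ha, not_not.2 hpa⟩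
      have e : S ∪ X = S.filter p ∪ (S.filter (fun x => ¬ p x) ∪ X) := by
        rw [← Finset.union_assoc, Finset.filter_union_filter_not_eq]
      rw [e]
      -- The second part is attached to `X` first, so that the first part is in relation `K` to the
      -- whole result.
      refine ih _ h1 (fun T hT => hS T (hT.trans h1.subset))
        (ih _ h2 (fun T hT => hS T (hT.trans h2.subset)) hX fun s hs => hSX s (h2.subset hs)) ?_
      intro s hs x hx
      rw [Finset.mem_filter] at hs
      rcases Finset.mem_union.1 hx with hx | hx
      · rw [Finset.mem_filter] at hx
        exact h s hs.1 hs.2 x hx.1 hx.2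
      · exact hSX s hs.1 x hx

section Copies

variable (hG : ∀ v, ¬ G.Adj v v) {S : Finset V} {x y z : V}

include hG

theorem hasCopy_Y1 (hx : x ∈ S) (hy : y ∈ S) (h : BiAdj G x y) : HasCopy G S Y1 := by
  have n : x ≠ y := fun e => hG x (e ▸ h.1)
  refine hasCopy_of_map ![x, y] ?_ ?_ ?_
  · simp [Fin.forall_fin_succ, n, n.symm]
  · simp [Fin.forall_fin_succ, Y1, ofArcs, hG, h.1, h.2]
  · simp [Fin.forall_fin_succ, hx, hy]

theorem hasCopy_Y2 (hx : x ∈ S) (hy : y ∈ S) (h : Arc G x y) : HasCopy G S Y2 := by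
  refine hasCopy_of_map ![x, y] ?_ ?_ ?_
  · simp [Fin.forall_fin_succ, h.ne, h.ne.symm]
  · simp [Fin.forall_fin_succ, Y2, ofArcs, hG, h.1, h.2]
  · simp [Fin.forall_fin_succ, hx, hy]

theorem hasCopy_Y3 (hx : x ∈ S) (hy : y ∈ S) (hz : z ∈ S) (h : BiAdj G x y)
    (hxz : NonAdj G x z) (hyz : NonAdj G y z) : HasCopy G S Y3 := by
  have n : x ≠ y := fun e => hG x (e ▸ h.1)
  refine hasCopy_of_map ![x, y, z] ?_ ?_ ?_
  · simp [Fin.forall_fin_succ, n, n.symm, hxz.1, hyz.1, hxz.1.symm, hyz.1.symm]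
  · simp [Fin.forall_fin_succ, Y3, ofArcs, hG, h.1, h.2, hxz.2, hyz.2]
  · simp [Fin.forall_fin_succ, hx, hy, hz]

theorem hasCopy_Y4 (hx : x ∈ S) (hy : y ∈ S) (hz : z ∈ S) (h : Arc G x y)
    (hxz : NonAdj G x z) (hyz : NonAdj G y z) : HasCopy G S Y4 := by
  refine hasCopy_of_map ![x, y, z] ?_ ?_ ?_
  · simp [Fin.forall_fin_succ, h.ne, h.ne.symm, hxz.1, hyz.1, hxz.1.symm, hyz.1.symm]
  · simp [Fin.forall_fin_succ, Y4, ofArcs, hG, h.1, h.2, hxz.2, hyz.2]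
  · simp [Fin.forall_fin_succ, hx, hy, hz]

variable {X Y : Finset V} {W W' : Type} {H : Digraph W} {H' : Digraph W'}

theorem IsFree.false_of_series {F : Set (Σ W : Type, Digraph W)} (hF : IsFree F G)
    (h : ⟨_, series H H'⟩ ∈ F) (hX : HasCopy G X H) (hY : HasCopy G Y H')
    (hXY : ∀ x ∈ X, ∀ y ∈ Y, BiAdj G x y) : False := by
  obtain ⟨f, hf⟩ := hX
  obtain ⟨g, hg⟩ := hY
  have hfg (a b) : BiAdj G (f a) (g b) := hXY _ (hf a) _ (hg b)
  have hne (a b) : f a ≠ g b := fun e => hG (f a) (by simpa [← e] using (hfg a b).1)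
  refine hF.false_of_map h (Sum.elim f g) ?_ ?_
  · rintro (a | a) (b | b) <;> simp [hne, (hne _ _).symm]
  · rintro (a | a) (b | b) <;> simp [series, f.map_rel_iff, g.map_rel_iff, (hfg _ _).1, (hfg _ _).2]

omit hG in
theorem IsFree.false_of_order {F : Set (Σ W : Type, Digraph W)} (hF : IsFree F G)
    (h : ⟨_, order H H'⟩ ∈ F) (hX : HasCopy G X H) (hY : HasCopy G Y H')
    (hXY : ∀ x ∈ X, ∀ y ∈ Y, Arc G x y) : False := by
  obtain ⟨f, hf⟩ := hX
  obtain ⟨g, hg⟩ := hY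
  have hfg (a b) : Arc G (f a) (g b) := hXY _ (hf a) _ (hg b)
  have hne (a b) : f a ≠ g b := (hfg a b).ne
  refine hF.false_of_map h (Sum.elim f g) ?_ ?_
  · rintro (a | a) (b | b) <;> simp [hne, (hne _ _).symm]
  · rintro (a | a) (b | b) <;> simp [order, f.map_rel_iff, g.map_rel_iff, (hfg _ _).1, (hfg _ _).2]

end Copies

theorem independent_of_card_le_one (hG : ∀ v, ¬ G.Adj v v) {T : Finset V} (hT : T.card ≤ 1) :
    Independent G T := by
  intro x hx y hy
  rw [Finset.card_le_one.1 hT x hx y hy]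
  exact hG y

/-- In a disjoint union, every arc misses some vertex. -/
theorem Splits.exists_nonAdj {T : Finset V} (hT : Splits (NonAdj G) T) {x y : V} (hx : x ∈ T)
    (hy : y ∈ T) (hxy : G.Adj x y) : ∃ z ∈ T, NonAdj G x z ∧ NonAdj G y z := by
  obtain ⟨p, ⟨a, ha, hpa⟩, ⟨b, hb, hpb⟩, h⟩ := hT
  by_cases hpx : p x
  · have hpy : p y := by
      by_contra hpy
      exact (h x hx hpx y hy hpy).2.1 hxy
    exact ⟨b, hb, h x hx hpx b hb hpb, h y hy hpy b hb hpb⟩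
  · have hpy : ¬ p y := fun hpy => (h y hy hpy x hx hpx).2.2 hxy
    exact ⟨a, ha, (h a ha hpa x hx hpx).symm, (h a ha hpa y hy hpy).symm⟩

/-- Needed when the decomposable part is the target of an order composition: its pieces are then
attached as sinks, along reversed arcs. -/
theorem Splits.flip {K : V → V → Prop} {T : Finset V} (hT : Splits K T) :
    Splits (fun x y => K y x) T := by
  obtain ⟨p, hp, hp', h⟩ := hT
  exact ⟨fun x => ¬ p x, hp', by simpa using hp,
    fun x hx hpx y hy hpy => h y hy (not_not.1 hpy) x hx hpx⟩

variable (hG : ∀ v, ¬ G.Adj v v) (hF : IsFree forbiddenDQ G)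

include hG hF

/-- Without Y₂ there are no one-way arcs, hence no order splitting. In a disjoint union, a two-way
pair and a vertex missing both ends would form Y₃. -/
theorem independent_or_splits_biAdj {S : Finset V} (h2 : ¬ HasCopy G S Y2) (h3 : ¬ HasCopy G S Y3)
    {T : Finset V} (hTS : T ⊆ S) : Independent G T ∨ Splits (BiAdj G) T := by
  classical
  have harc {x y : V} (hx : x ∈ T) (hy : y ∈ T) : ¬ Arc G x y := fun h =>
    h2 (hasCopy_Y2 hG (hTS hx) (hTS hy) h)
  rcases le_or_gt T.card 1 with h | h
  · exact Or.inl (independent_of_card_le_one hG h)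
  rcases splits_of_one_lt_card hG hF h with h | h | h
  · left
    intro x hx y hy hxy
    obtain ⟨z, hz, hxz, hyz⟩ := h.exists_nonAdj hx hy hxy
    exact h3 (hasCopy_Y3 hG (hTS hx) (hTS hy) (hTS hz)
      ⟨hxy, by_contra fun h => harc hx hy ⟨hxy, h⟩⟩ hxz hyz)
  · exact Or.inr h
  · obtain ⟨p, ⟨a, ha, hpa⟩, ⟨b, hb, hpb⟩, h⟩ := h
    exact (harc ha hb (h a ha hpa b hb hpb)).elim

theorem independent_or_splits_arc {S : Finset V} (h1 : ¬ HasCopy G S Y1) (h4 : ¬ HasCopy G S Y4)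
    {T : Finset V} (hTS : T ⊆ S) : Independent G T ∨ Splits (Arc G) T := by
  classical
  have hbi {x y : V} (hx : x ∈ T) (hy : y ∈ T) : ¬ BiAdj G x y := fun h =>
    h1 (hasCopy_Y1 hG (hTS hx) (hTS hy) h)
  rcases le_or_gt T.card 1 with h | h
  · exact Or.inl (independent_of_card_le_one hG h)
  rcases splits_of_one_lt_card hG hF h with h | h | h
  · left
    intro x hx y hy hxy
    obtain ⟨z, hz, hxz, hyz⟩ := h.exists_nonAdj hx hy hxy
    exact h4 (hasCopy_Y4 hG (hTS hx) (hTS hy) (hTS hz)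
      ⟨hxy, fun h => hbi hx hy ⟨hxy, h⟩⟩ hxz hyz)
  · obtain ⟨p, ⟨a, ha, hpa⟩, ⟨b, hb, hpb⟩, h⟩ := h
    exact (hbi ha hb (h a ha hpa b hb hpb)).elim
  · exact Or.inr h

/-- If both parts contained Y₂ or Y₃, the composition would contain Q₁, Q₃ or Q₄; Q₄ serves both
mixed cases because series composition is symmetric. -/
theorem not_hasCopy_or_of_biAdj {X Y : Finset V} (h : ∀ x ∈ X, ∀ y ∈ Y, BiAdj G x y) :
    (¬ HasCopy G X Y2 ∧ ¬ HasCopy G X Y3) ∨ (¬ HasCopy G Y Y2 ∧ ¬ HasCopy G Y Y3) := by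
  have h' : ∀ y ∈ Y, ∀ x ∈ X, BiAdj G y x := fun y hy x hx => (h x hx y hy).symm
  have q1 (a : HasCopy G X Y2) (b : HasCopy G Y Y2) : False :=
    hF.false_of_series hG (by simp [forbiddenDQ, Q1]) a b h
  have q3 (a : HasCopy G X Y3) (b : HasCopy G Y Y3) : False :=
    hF.false_of_series hG (by simp [forbiddenDQ, Q3]) a b h
  have q4 (a : HasCopy G X Y2) (b : HasCopy G Y Y3) : False :=
    hF.false_of_series hG (by simp [forbiddenDQ, Q4]) a b h
  have q4' (a : HasCopy G X Y3) (b : HasCopy G Y Y2) : False :=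
    hF.false_of_series hG (by simp [forbiddenDQ, Q4]) b a h'
  tauto

omit hG in
theorem not_hasCopy_or_of_arc {X Y : Finset V} (h : ∀ x ∈ X, ∀ y ∈ Y, Arc G x y) :
    (¬ HasCopy G X Y1 ∧ ¬ HasCopy G X Y4) ∨ (¬ HasCopy G Y Y1 ∧ ¬ HasCopy G Y Y4) := by
  have q2 (a : HasCopy G X Y1) (b : HasCopy G Y Y1) : False :=
    hF.false_of_order (by simp [forbiddenDQ, Q2]) a b h
  have q5 (a : HasCopy G X Y1) (b : HasCopy G Y Y4) : False :=
    hF.false_of_order (by simp [forbiddenDQ, Q5]) a b h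
  have q6 (a : HasCopy G X Y4) (b : HasCopy G Y Y1) : False :=
    hF.false_of_order (by simp [forbiddenDQ, Q6]) a b h
  have q7 (a : HasCopy G X Y4) (b : HasCopy G Y Y4) : False :=
    hF.false_of_order (by simp [forbiddenDQ, Q7]) a b h
  tauto

omit hF in
theorem independent_or_of_nonAdj (hC : IsFree forbiddenCoD G) {X Y : Finset V}
    (h : ∀ x ∈ X, ∀ y ∈ Y, NonAdj G x y) : Independent G X ∨ Independent G Y := by
  by_contra hc
  simp only [Independent, not_or] at hc
  push Not at hc
  obtain ⟨⟨a, ha, b, hb, hab⟩, c, hc, d, hd, hcd⟩ := hc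
  have n1 : a ≠ b := fun e => hG a (by simpa [← e] using hab)
  have n2 : c ≠ d := fun e => hG c (by simpa [← e] using hcd)
  have hac := h a ha c hc
  have had := h a ha d hd
  have hbc := h b hb c hc
  have hbd := h b hb d hd
  simp only [NonAdj] at hac had hbc hbd
  have hinj : ∀ x y : V, ∀ z w : V, x ≠ y → z ≠ w → x ≠ z → x ≠ w → y ≠ z → y ≠ w →
      ∀ i j, Sum.elim ![x, y] ![z, w] i = Sum.elim ![x, y] ![z, w] j → i = j := by
    intro x y z w h1 h2 h3 h4 h5 h6
    simp [Fin.forall_fin_succ, *, h1.symm, h2.symm, h3.symm, h4.symm, h5.symm, h6.symm]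
  by_cases hba : G.Adj b a <;> by_cases hdc : G.Adj d c
  · refine hC.false_of_map (H := co D9) (by simp [forbiddenCoD]) (Sum.elim ![a, b] ![c, d])
      (hinj _ _ _ _ n1 n2 hac.1 had.1 hbc.1 hbd.1) ?_
    simp [Fin.forall_fin_succ, co, D9, series, edgeless, *]
  -- The complement reverses the arc of Y₂, so a one-way pair is listed head first.
  · refine hC.false_of_map (H := co D10) (by simp [forbiddenCoD]) (Sum.elim ![a, b] ![d, c])
      (hinj _ _ _ _ n1 n2.symm had.1 hac.1 hbd.1 hbc.1) ?_
    simp [Fin.forall_fin_succ, co, D10, Y2, ofArcs, series, edgeless, *]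
  · refine hC.false_of_map (H := co D10) (by simp [forbiddenCoD]) (Sum.elim ![c, d] ![b, a])
      (hinj _ _ _ _ n2 n1.symm hbc.1.symm hac.1.symm hbd.1.symm had.1.symm) ?_
    simp [Fin.forall_fin_succ, co, D10, Y2, ofArcs, series, edgeless, *]
  · refine hC.false_of_map (H := co D11) (by simp [forbiddenCoD]) (Sum.elim ![b, a] ![d, c])
      (hinj _ _ _ _ n1.symm n2.symm hbd.1 hbc.1 had.1 hac.1) ?_
    simp [Fin.forall_fin_succ, co, D11, Y2, ofArcs, series, *]

theorem isDirectedSimpleCograph_induced (hC : IsFree forbiddenCoD G) {S : Finset V}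
    (hS : S.Nonempty) : IsDirectedSimpleCograph (induced G S) := by
  classical
  induction S using Finset.strongInduction with
  | H S ih =>
    rcases le_or_gt S.card 1 with h | h
    · obtain ⟨z, rfl⟩ := Finset.card_eq_one.1 (le_antisymm h hS.card_pos)
      convert IsDirectedSimpleCograph.single ({z} : Finset V)
      simp only [induced, edgeless, Digraph.mk.injEq]
      ext a b
      simp [Subsingleton.elim a b, hG]
    -- Both parts are proper and nonempty, so the induction hypothesis covers them whichever
    -- relation splits `S`.
    have part {K : V → V → Prop} (h : Splits K S) : ∃ X Y, S = X ∪ Y ∧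
        IsDirectedSimpleCograph (induced G X) ∧ IsDirectedSimpleCograph (induced G Y) ∧
        ∀ x ∈ X, ∀ y ∈ Y, K x y := by
      obtain ⟨p, ⟨a, ha, hpa⟩, ⟨b, hb, hpb⟩, h⟩ := h
      refine ⟨S.filter p, S.filter (fun x => ¬ p x), (Finset.filter_union_filter_not_eq _ _).symm,
        ih _ (Finset.filter_ssubset.2 ⟨b, hb, hpb⟩) ⟨a, by simp [ha, hpa]⟩,
        ih _ (Finset.filter_ssubset.2 ⟨a, ha, not_not.2 hpa⟩) ⟨b, by simp [hb, hpb]⟩, ?_⟩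
      intro x hx y hy
      rw [Finset.mem_filter] at hx hy
      exact h x hx.1 hx.2 y hy.1 hy.2
    rcases splits_of_one_lt_card hG hF h with h | h | h <;>
      obtain ⟨X, Y, rfl, hX, hY, hXY⟩ := part h
    · rcases independent_or_of_nonAdj hG hC hXY with hI | hI
      · exact isDirectedSimpleCograph_induced_union_of_nonAdj hY hI hXY
      · rw [Finset.union_comm]
        exact isDirectedSimpleCograph_induced_union_of_nonAdj hX hI
          fun y hy x hx => (hXY x hx y hy).symm
    · have attach (X I : Finset V) (hX : IsDirectedSimpleCograph (induced G X))
          (hI : Independent G I) (h : ∀ i ∈ I, ∀ x ∈ X, BiAdj G i x) :=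
        isDirectedSimpleCograph_induced_union_of_biAdj hX hI hG h
      rcases not_hasCopy_or_of_biAdj hG hF hXY with hI | hI
      · exact isDirectedSimpleCograph_induced_union_of_splits attach
          (fun T hT => independent_or_splits_biAdj hG hF hI.1 hI.2 hT) hY hXY
      · rw [Finset.union_comm]
        exact isDirectedSimpleCograph_induced_union_of_splits attach
          (fun T hT => independent_or_splits_biAdj hG hF hI.1 hI.2 hT) hX
          fun y hy x hx => (hXY x hx y hy).symm
    · rcases not_hasCopy_or_of_arc hF hXY with hI | hI
      · exact isDirectedSimpleCograph_induced_union_of_splits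
          (fun X I => isDirectedSimpleCograph_induced_union_of_arc_from)
          (fun T hT => independent_or_splits_arc hG hF hI.1 hI.2 hT) hY hXY
      · rw [Finset.union_comm]
        exact isDirectedSimpleCograph_induced_union_of_splits (K := fun x y => Arc G y x)
          (fun X I => isDirectedSimpleCograph_induced_union_of_arc_to)
          (fun T hT => (independent_or_splits_arc hG hF hI.1 hI.2 hT).imp_right Splits.flip) hX
          fun y hy x hx => hXY x hx y hy

theorem isDirectedSimpleCograph_of_isFree [Finite V] [Nonempty V] (hC : IsFree forbiddenCoD G) :
    IsDirectedSimpleCograph G := by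
  have := Fintype.ofFinite V
  refine (isDirectedSimpleCograph_induced hG hF hC Finset.univ_nonempty).iso
    ⟨Equiv.subtypeUnivEquiv Finset.mem_univ, ?_⟩
  intro a b
  rfl

end Sufficiency

end SimpleCograph

/-- `G.toSimpleGraphInclusive` is the underlying undirected graph of `G`. -/
theorem mainTheorem10 {V : Type*} [Finite V] [Nonempty V] (G : Digraph V)
    (hG : ∀ v, ¬ G.Adj v v) :
    List.TFAE [
      SimpleCograph.IsDirectedSimpleCograph G,
      SimpleCograph.IsFree (SimpleCograph.forbiddenDQ ∪ SimpleCograph.forbiddenCoD) G,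
      SimpleCograph.IsFree SimpleCograph.forbiddenDQ G ∧
        SimpleCograph.IsGraphFree SimpleCograph.forbiddenSC G.toSimpleGraphInclusive,
      SimpleCograph.IsFree SimpleCograph.forbiddenDQ G ∧
        SimpleCograph.IsSimpleCograph G.toSimpleGraphInclusive] := by
  tfae_have 1 → 4 := fun h => ⟨h.isFree_forbiddenDQ, h.isSimpleCograph⟩
  tfae_have 4 → 3 := fun h => ⟨h.1, h.2.isGraphFree_forbiddenSC⟩
  tfae_have 3 → 2 := fun h H hH =>
    hH.elim (h.1 H) (SimpleCograph.isFree_forbiddenCoD h.2 H)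
  tfae_have 2 → 1 := fun h => SimpleCograph.isDirectedSimpleCograph_of_isFree hG
    (fun H hH => h H (Or.inl hH)) (fun H hH => h H (Or.inr hH))
  tfae_finish
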